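/- Notation. Let $d\ge 1$, and for $1\le k\le d$ let $\mathcal G_{k,d}=\{P\in\mathbb R^{d\times d}: P^\top=P,\ P^2=P,\ \operatorname{trace}P=k\}$, equipped with the probability measure $\sigma_{k,d}$ induced by the Haar measure on the orthogonal group $\mathcal O(d)$ (the law of $UD_kU^\top$, where $D_k$ is the projection onto the first $k$ coordinates and $U$ is Haar distributed), and let $\langle M,P\rangle=\operatorname{trace}(MP)$. For $\ell,t\in\mathbb N_0$ let $\mathrm{Pol}^\ell_t(\mathcal G_{k,d})$ be the span of the functions $P\mapsto\langle M,P\rangle^s$ with $M$ symmetric, $\operatorname{rank}M\le\ell$, $s\le t$, and let $\mathrm{Pol}_t(\mathcal G_{k,d})$ be the space of restrictions to $\mathcal G_{k,d}$ of polynomials of degree at most $t$ in the matrix entries. A finite family $\{(P_j,\omega_j)\}_{j=1}^n$ in $\mathcal G_{k,d}\times\mathbb R$ is a cubature for a space $V$ of functions on $\mathcal G_{k,d}$ if $\sum_j\omega_jf(P_j)=\int f\,d\sigma_{k,d}$ for all $f\in V$. Let $K_t(P,Q)=\langle P,Q\rangle^t$; its shifts span $\mathrm{Pol}_t(\mathcal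 G_{k,d})$, and $\|\sum_ic_iK_t(P_i,\cdot)\|_{K_t}^2=\sum_{i,j}c_ic_jK_t(P_i,P_j)$. The family is an $\epsilon$-approximate cubature for $\mathrm{Pol}_t(\mathcal G_{k,d})$ with respect to $K_t$ if $$\sup_{f\in\mathrm{Pol}_t(\mathcal G_{k,d}),\ \|f\|_{K_t}=1}\Big|\sum_{j=1}^n\omega_jf(P_j)-\int f\,d\sigma_{k,d}\Big|\le\epsilon .$$ Theorem. Let $\alpha\in\mathbb N_0^d$ and $t=|\alpha|$. (1) Let $1\le k\le d$. There are real coefficients $(a_\beta)_{|\beta|\le t}$ such that, for every cubature $\{(P_j,\omega_j)\}_{j=1}^n$ for $\mathrm{Pol}^2_t(\mathcal G_{k,d})$ and every random vector $X$ in $\mathbb R^d$ with $\|X\|=1$ almost surely, $$\mathbb E X^\alpha=\sum_{|\beta|\le t}a_\beta\sum_{j=1}^n\omega_j\,\mathbb E(P_jX)^\beta .$$ For any such coefficients there is a constant $c_\alpha$ such that, for all $\epsilon$, every $\epsilon$-approximate cubature $\{(P_j,\omega_j)\}_{j=1}^n$ for $\mathrm{Pol}_t(\mathcal G_{k,d})$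 with respect to $K_t$, and every random vector $X$ with $\|X\|=1$ almost surely, $$\Big|\mathbb E X^\alpha-\sum_{|\beta|\le t}a_\beta\sum_{j=1}^n\omega_j\,\mathbb E(P_jX)^\beta\Big|\le\epsilon\,c_\alpha .$$ (2) Let $k=1$ and $t\le d$. There are real coefficients $(a_\beta)_{|\beta|=t}$ such that, for every cubature $\{(P_j,\omega_j)\}_{j=1}^n$ for $\mathrm{Pol}^3_t(\mathcal G_{1,d})$ and every random vector $X$ in $\mathbb R^d$ with $\mathbb E\|X\|^t<\infty$, $$\mathbb E X^\alpha=\sum_{|\beta|=t}a_\beta\sum_{j=1}^n\omega_j\,\mathbb E(P_jX)^\beta .$$ For any such coefficients there is a constant $c$ such that, for all $\epsilon$, every $\epsilon$-approximate cubature $\{(P_j,\omega_j)\}_{j=1}^n$ for $\mathrm{Pol}_t(\mathcal G_{1,d})$ with respect to $K_t$, and every random vector $X$ in $\mathbb R^d$ with $\mathbb E\|X\|^t<\infty$, $$\Big|\mathbb E X^\alpha-\sum_{|\beta|=t}a_\beta\sum_{j=1}^n\omega_j\,\mathbb E(P_jX)^\beta\Big|\le c\,\epsilon\,\mathbb E\|X\|^t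 .$$ -/

import Mathlib

open MeasureTheory
open scoped Matrix

universe u

noncomputable section

namespace MomentFusion

/-- The trace inner product `⟨M₁, M₂⟩ = trace (M₁ M₂)` on symmetric `d × d` matrices. -/
def trInner {d : ℕ} (M₁ M₂ : Matrix (Fin d) (Fin d) ℝ) : ℝ := (M₁ * M₂).trace

/-- The Grassmann space `𝒢_{k,d}` of rank-`k` orthogonal projections on `ℝ^d`. -/
def Grassmannian (k d : ℕ) : Type :=
  {P : Matrix (Fin d) (Fin d) ℝ // P.IsSymm ∧ P * P = P ∧ P.trace = k}

/-- The matrix of a point of the Grassmann space. -/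
def Grassmannian.mat {k d : ℕ} (P : Grassmannian k d) : Matrix (Fin d) (Fin d) ℝ := P.1

instance (k d : ℕ) : TopologicalSpace (Grassmannian k d) :=
  inferInstanceAs (TopologicalSpace
    {P : Matrix (Fin d) (Fin d) ℝ // P.IsSymm ∧ P * P = P ∧ P.trace = k})

instance (k d : ℕ) : MeasurableSpace (Grassmannian k d) := borel _

instance (k d : ℕ) : BorelSpace (Grassmannian k d) := ⟨rfl⟩

/-! ### The orthogonal group and its normalized Haar measure -/

instance (d : ℕ) : MeasurableSpace (Matrix.orthogonalGroup (Fin d) ℝ) := borel _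

instance (d : ℕ) : BorelSpace (Matrix.orthogonalGroup (Fin d) ℝ) := ⟨rfl⟩

instance (d : ℕ) : CompactSpace (Matrix.orthogonalGroup (Fin d) ℝ) := by
  have hc : IsCompact (Set.univ.pi fun _ : Fin d => Set.univ.pi fun _ : Fin d =>
      Set.Icc (-1 : ℝ) 1) :=
    isCompact_univ_pi fun _ => isCompact_univ_pi fun _ => isCompact_Icc
  have hcl : IsClosed ((unitary (Matrix (Fin d) (Fin d) ℝ) :
      Submonoid _) : Set (Matrix (Fin d) (Fin d) ℝ)) := isClosed_unitary
  refine isCompact_iff_compactSpace.mp (IsCompact.of_isClosed_subset hc hcl ?_)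
  intro U hU i _ j _
  have h := entry_norm_bound_of_unitary (𝕜 := ℝ) (U := U) hU i j
  rw [Real.norm_eq_abs] at h
  exact abs_le.mp h

/-- The Haar probability measure on the orthogonal group `𝒪(d)`. -/
def haarO (d : ℕ) : Measure (Matrix.orthogonalGroup (Fin d) ℝ) :=
  Measure.haarMeasure ⊤

/-- The action `P ↦ U P Uᵀ` of the orthogonal group on the Grassmann space. -/
def conj {k d : ℕ} (U : Matrix.orthogonalGroup (Fin d) ℝ) (P : Grassmannian k d) :
    Grassmannian k d :=
  ⟨U.1 * P.1 * U.1ᵀ, by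
    have hU : U.1ᵀ * U.1 = 1 := Matrix.UnitaryGroup.star_mul_self U
    obtain ⟨h1, h2, h3⟩ := P.2
    refine ⟨?_, ?_, ?_⟩
    · rw [Matrix.IsSymm, Matrix.transpose_mul, Matrix.transpose_mul, Matrix.transpose_transpose,
        h1.eq, Matrix.mul_assoc]
    · calc U.1 * P.1 * U.1ᵀ * (U.1 * P.1 * U.1ᵀ)
          = U.1 * P.1 * (U.1ᵀ * U.1) * P.1 * U.1ᵀ := by simp only [Matrix.mul_assoc]
        _ = U.1 * (P.1 * P.1) * U.1ᵀ := by rw [hU]; simp only [Matrix.mul_assoc, Matrix.one_mul]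
        _ = U.1 * P.1 * U.1ᵀ := by rw [h2]
    · rw [Matrix.trace_mul_comm, ← Matrix.mul_assoc, hU, Matrix.one_mul, h3]⟩

/-- The projection onto the first `k` coordinates. -/
def coordProj {k d : ℕ} (hkd : k ≤ d) : Grassmannian k d :=
  ⟨Matrix.diagonal fun i => if i.val < k then 1 else 0, by
    refine ⟨Matrix.isSymm_diagonal _, ?_, ?_⟩
    · rw [Matrix.diagonal_mul_diagonal]
      congr 1
      funext i
      split_ifs <;> simp
    · rw [Matrix.trace_diagonal, Finset.sum_boole]
      have h : (Finset.univ.filter fun i : Fin d => i.val < k).card = min d k := by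
        rw [Fin.card_filter_val_lt]
      rw [h, min_eq_right hkd]⟩

/-- The orthogonally invariant probability measure `σ_{k,d}` on `𝒢_{k,d}` that is induced by the
Haar measure on `𝒪(d)`. -/
def grassmannMeasure {k d : ℕ} (hkd : k ≤ d) : Measure (Grassmannian k d) :=
  (haarO d).map fun U => conj U (coordProj hkd)

/-! ### Polynomial spaces and cubatures -/

/-- `Pol^ℓ_t(𝒢_{k,d})`: the span of the functions `⟨M, ·⟩^s` on `𝒢_{k,d}`, with `M` symmetric of
rank at most `ℓ` and `s ≤ t`. -/
def PolRank (ℓ t k d : ℕ) : Submodule ℝ (Grassmannian k d → ℝ) :=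
  Submodule.span ℝ {f | ∃ (M : Matrix (Fin d) (Fin d) ℝ) (s : ℕ), M.IsSymm ∧ M.rank ≤ ℓ ∧ s ≤ t ∧
    f = fun P => trInner M P.mat ^ s}

/-- `Pol_t(𝒢_{k,d})`: the polynomials of degree at most `t` in the matrix entries, restricted to
`𝒢_{k,d}`. -/
def Pol (t k d : ℕ) : Set (Grassmannian k d → ℝ) :=
  {f | ∃ p : MvPolynomial (Fin d × Fin d) ℝ, p.totalDegree ≤ t ∧
    f = fun P => p.eval fun ij => P.mat ij.1 ij.2}

/-- `{(P_j, w_j)}` is a (weighted) cubature for the function space `V` on `𝒢_{k,d}`. -/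
def IsCubature {k d n : ℕ} (hkd : k ≤ d) (V : Set (Grassmannian k d → ℝ))
    (P : Fin n → Grassmannian k d) (w : Fin n → ℝ) : Prop :=
  ∀ f ∈ V, ∑ j, w j * f (P j) = ∫ Q, f Q ∂(grassmannMeasure hkd)

/-- The kernel `K_t(P, Q) = ⟨P, Q⟩^t` on `𝒢_{k,d}`. -/
def kernelK {k d : ℕ} (t : ℕ) (P Q : Grassmannian k d) : ℝ := trInner P.mat Q.mat ^ t

/-- The norm induced by a positive definite kernel `K` on the span of its shifts:
`‖f‖² = ∑_{i,j} c_i c_j K(P_i, P_j)` whenever `f = ∑_i c_i K(P_i, ·)`. The value does not depend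
on the representation, so that the infimum is over a singleton. -/
def kernelNorm {S : Type*} (K : S → S → ℝ) (f : S → ℝ) : ℝ :=
  sInf {r | ∃ c : S →₀ ℝ, (f = fun Q => c.sum fun P a => a * K P Q) ∧
    r = Real.sqrt (c.sum fun P a => c.sum fun Q b => a * b * K P Q)}

/-- `{(P_j, w_j)}` is an `ε`-approximate cubature for `Pol_t(𝒢_{k,d})` with respect to `K_t`: the
supremum of the cubature error over the unit sphere of `‖·‖_{K_t}` is at most `ε`. -/
def IsApproxCubature {k d n : ℕ} (hkd : k ≤ d) (t : ℕ) (ε : ℝ)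
    (P : Fin n → Grassmannian k d) (w : Fin n → ℝ) : Prop :=
  ∀ f ∈ Pol t k d, kernelNorm (kernelK t) f = 1 →
    |∑ j, w j * f (P j) - ∫ Q, f Q ∂(grassmannMeasure hkd)| ≤ ε

/-! ### Moments -/

/-- The monomial `x^α = x_1^{α_1} ⋯ x_d^{α_d}`. -/
def mono {d : ℕ} (x : Fin d → ℝ) (α : Fin d → ℕ) : ℝ := ∏ i, x i ^ α i

/-- The multi-indices `β ∈ ℕ^d` with `|β| = t`. -/
def indexEq (d t : ℕ) : Finset (Fin d → ℕ) := Finset.piAntidiag Finset.univ t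

/-- The multi-indices `β ∈ ℕ^d` with `|β| ≤ t`. -/
def indexLE (d t : ℕ) : Finset (Fin d → ℕ) := (Finset.range (t + 1)).biUnion (indexEq d)

/-- The fused moments `∑_{β ∈ B} a_β ∑_j w_j 𝔼 (P_j X)^β`. -/
def fusedMoment {k d n : ℕ} (B : Finset (Fin d → ℕ)) (a : (Fin d → ℕ) → ℝ)
    (P : Fin n → Grassmannian k d) (w : Fin n → ℝ) {Ω : Type*} [MeasurableSpace Ω]
    (μ : Measure Ω) (X : Ω → EuclideanSpace ℝ (Fin d)) : ℝ :=
  ∑ β ∈ B, a β * ∑ j, w j * ∫ ω, mono ((P j).mat *ᵥ (X ω).ofLp) β ∂μ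

/-- The coefficients `a` reconstruct the moment `𝔼 X^α`, `|α| = t`, of random unit vectors: for every
cubature for `Pol^2_t(𝒢_{k,d})` and every random vector `X` in the unit sphere,
`𝔼 X^α = ∑_{|β| ≤ t} a_β ∑_j w_j 𝔼 (P_j X)^β`. -/
def ReconstructsSphere {k d : ℕ} (hkd : k ≤ d) (t : ℕ) (α : Fin d → ℕ)
    (a : (Fin d → ℕ) → ℝ) : Prop :=
  ∀ (n : ℕ) (P : Fin n → Grassmannian k d) (w : Fin n → ℝ),
    IsCubature hkd (PolRank 2 t k d) P w →
    ∀ (Ω : Type u) [MeasurableSpace Ω] (μ : Measure Ω) [IsProbabilityMeasure μ]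
      (X : Ω → EuclideanSpace ℝ (Fin d)), AEMeasurable X μ → (∀ᵐ ω ∂μ, ‖X ω‖ = 1) →
      ∫ ω, mono (X ω).ofLp α ∂μ = fusedMoment (indexLE d t) a P w μ X

/-- The coefficients `a` reconstruct the moment `𝔼 X^α`, `|α| = t`, of random vectors in `ℝ^d` from
projections of rank one: for every cubature for `Pol^3_t(𝒢_{1,d})` and every random vector `X` with
`𝔼 ‖X‖^t < ∞`, `𝔼 X^α = ∑_{|β| = t} a_β ∑_j w_j 𝔼 (P_j X)^β`. -/
def ReconstructsLine {d : ℕ} (hd : 1 ≤ d) (t : ℕ) (α : Fin d → ℕ)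
    (a : (Fin d → ℕ) → ℝ) : Prop :=
  ∀ (n : ℕ) (P : Fin n → Grassmannian 1 d) (w : Fin n → ℝ),
    IsCubature hd (PolRank 3 t 1 d) P w →
    ∀ (Ω : Type u) [MeasurableSpace Ω] (μ : Measure Ω) [IsProbabilityMeasure μ]
      (X : Ω → EuclideanSpace ℝ (Fin d)), AEMeasurable X μ →
      Integrable (fun ω => ‖X ω‖ ^ t) μ →
      ∫ ω, mono (X ω).ofLp α ∂μ = fusedMoment (indexEq d t) a P w μ X

end MomentFusion

end

namespace MomentFusion

/-! ### Polarization -/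

section Polarization

variable {ι : Type*} [Fintype ι]

/-! Everything reduces to the pointwise identity x^α = ∑ a_β ∫ (Qx)^β dσ(Q), for unit x in the first
part and for all x in the second. For fixed x, y⬝Qx is the trace pairing of Q with a symmetric
matrix of rank at most 2. By polarization (`monomial_mem_of_forall_pow_mem`), Q ↦ (Qx)^β therefore
lies in `PolRank 2`, and an exact cubature reproduces its average (`mono_mulVec_mem_polRank`).

Coefficients on the sphere: for unit x, y, the vectors x + y and x - y are orthogonal. Invariance of
σ thus turns the m-th moment of y⬝Qx into a polynomial in ⟨x, y⟩ of degree m, whose leading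
coefficient is the moment of a nonnegative, not identically zero function
(`exists_integral_dotProduct_pow`). This is a triangular system, solved for ⟨x, y⟩^m by induction;
polarization then gives monomials.

Coefficients for rank one: Q = uuᵀ gives (Qx)^β = u^β (u⬝x)^t. Up to multinomial factors, the
averages are obtained from the monomials of degree t by their Gram matrix in L² of the sphere, which
is positive definite because a form vanishing on the sphere is zero (`exists_mono_eq_sum_line`).

Approximate cubatures: arbitrary reconstructing coefficients are tested on deterministic vectors.
Exact cubatures exist (`exists_isCubature`), so these coefficients satisfy the pointwise identity.
Expanding (Qx)^β in products of entries of Q separates Q from x; each product lies in `Pol`, where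
the cubature error is at most ε times the kernel norm. That norm is computed with the feature map Q
↦ Q^{⊗t}. -/

theorem multinomial_ne_zero (β : ι → ℕ) : (Nat.multinomial Finset.univ β : ℝ) ≠ 0 :=
  Nat.cast_ne_zero.mpr (Nat.multinomial_pos _ _).ne'

variable [DecidableEq ι]

/-- A homogeneous form that vanishes at all points has vanishing coefficients. -/
theorem coeff_eq_zero_of_forall_eval (n : ℕ) (l : (ι → ℕ) → ℝ)
    (h : ∀ y : ι → ℝ, ∑ β ∈ Finset.piAntidiag Finset.univ n, l β * ∏ i, y i ^ β i = 0)
    {β : ι → ℕ} (hβ : β ∈ Finset.piAntidiag Finset.univ n) : l β = 0 := by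
  classical
  set p : MvPolynomial ι ℝ := ∑ γ ∈ Finset.piAntidiag Finset.univ n,
    MvPolynomial.monomial (Finsupp.equivFunOnFinite.symm γ) (l γ) with hp
  have hp0 : p = 0 := by
    refine MvPolynomial.funext fun y => ?_
    rw [hp, map_sum, map_zero, ← h y]
    refine Finset.sum_congr rfl fun γ _ => ?_
    rw [MvPolynomial.eval_monomial, Finsupp.prod_fintype _ _ (fun i => pow_zero _)]
    rfl
  have hc := congrArg (MvPolynomial.coeff (Finsupp.equivFunOnFinite.symm β)) hp0
  rw [hp, MvPolynomial.coeff_sum] at hc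
  simpa [MvPolynomial.coeff_monomial, hβ] using hc

/-- If a space of functions contains the powers of all linear combinations of the functions `g i`,
then it contains their monomials. -/
theorem monomial_mem_of_forall_pow_mem {S : Type*} (W : Submodule ℝ (S → ℝ)) (g : S → ι → ℝ) (n : ℕ)
    (h : ∀ y : ι → ℝ, (fun s => (∑ i, y i * g s i) ^ n) ∈ W)
    {β : ι → ℕ} (hβ : ∑ i, β i = n) : (fun s => ∏ i, g s i ^ β i) ∈ W := by
  -- A functional that kills W but not the monomial turns the multinomial expansion into a form in y
  -- that vanishes identically, so its β-coefficient is zero.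
  by_contra hv
  obtain ⟨f, hf, hW⟩ := Submodule.exists_le_ker_of_notMem hv
  refine hf ((mul_eq_zero.mp (coeff_eq_zero_of_forall_eval n
    (fun γ => (Nat.multinomial Finset.univ γ : ℝ) * f fun s => ∏ i, g s i ^ γ i) ?_
    (β := β) (by simp [hβ]))).resolve_left (multinomial_ne_zero β))
  intro y
  rw [← LinearMap.mem_ker.mp (hW (h y))]
  have : (fun s => (∑ i, y i * g s i) ^ n) = ∑ γ ∈ Finset.piAntidiag Finset.univ n,
      ((Nat.multinomial Finset.univ γ : ℝ) * ∏ i, y i ^ γ i) • fun s => ∏ i, g s i ^ γ i := by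
    funext s
    rw [Finset.sum_pow_eq_sum_piAntidiag, Finset.sum_apply]
    refine Finset.sum_congr rfl fun γ _ => ?_
    simp only [mul_pow, Finset.prod_mul_distrib, Pi.smul_apply, smul_eq_mul]
    ring
  rw [this, map_sum]
  refine Finset.sum_congr rfl fun γ _ => ?_
  rw [map_smul, smul_eq_mul]
  ring

end Polarization

/-! ### The invariant measures -/

instance (d : ℕ) : IsProbabilityMeasure (haarO d) := by
  constructor
  have h := Measure.haarMeasure_self (K₀ := (⊤ : TopologicalSpace.PositiveCompacts
    (Matrix.orthogonalGroup (Fin d) ℝ)))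
  simpa [haarO] using h

instance (d : ℕ) : (haarO d).IsMulLeftInvariant := by unfold haarO; infer_instance

instance (d : ℕ) : (haarO d).IsOpenPosMeasure := by unfold haarO; infer_instance

theorem integrable_haarO {d : ℕ} {f : Matrix.orthogonalGroup (Fin d) ℝ → ℝ} (hf : Continuous f) :
    Integrable f (haarO d) :=
  hf.integrable_of_hasCompactSupport (HasCompactSupport.of_compactSpace f)

variable {k d : ℕ}

theorem continuous_mat : Continuous (Grassmannian.mat (k := k) (d := d)) := continuous_subtype_val

theorem continuous_entry (i j : Fin d) : Continuous fun Q : Grassmannian k d => Q.mat i j :=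
  (continuous_apply j).comp ((continuous_apply i).comp continuous_mat)

theorem continuous_mulVec_apply (x : Fin d → ℝ) (i : Fin d) :
    Continuous fun Q : Grassmannian k d => (Q.mat *ᵥ x) i := by
  simp only [Matrix.mulVec, dotProduct]
  exact continuous_finsetSum _ fun j _ => (continuous_entry i j).mul continuous_const

theorem continuous_mono_mulVec (x : Fin d → ℝ) (β : Fin d → ℕ) :
    Continuous fun Q : Grassmannian k d => mono (Q.mat *ᵥ x) β :=
  continuous_finsetProd _ fun i _ => (continuous_mulVec_apply x i).pow _

theorem continuous_conj (P : Grassmannian k d) :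
    Continuous fun U : Matrix.orthogonalGroup (Fin d) ℝ => conj U P := by
  refine Continuous.subtype_mk ?_ _
  exact (continuous_subtype_val.matrix_mul continuous_const).matrix_mul
    continuous_subtype_val.matrix_transpose

theorem continuous_conj_right (U : Matrix.orthogonalGroup (Fin d) ℝ) :
    Continuous fun P : Grassmannian k d => conj U P := by
  refine Continuous.subtype_mk ?_ _
  exact (continuous_const.matrix_mul continuous_subtype_val).matrix_mul continuous_const

theorem conj_mul (U V : Matrix.orthogonalGroup (Fin d) ℝ) (P : Grassmannian k d) :
    conj (U * V) P = conj U (conj V P) := by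
  refine Subtype.ext ?_
  change (U.1 * V.1) * P.1 * (U.1 * V.1)ᵀ = U.1 * (V.1 * P.1 * V.1ᵀ) * U.1ᵀ
  rw [Matrix.transpose_mul]
  simp only [Matrix.mul_assoc]

theorem conj_one (P : Grassmannian k d) : conj 1 P = P := by
  refine Subtype.ext ?_
  change (1 : Matrix (Fin d) (Fin d) ℝ) * P.1 * (1 : Matrix (Fin d) (Fin d) ℝ)ᵀ = P.1
  simp

theorem integral_grassmannMeasure (hkd : k ≤ d) {f : Grassmannian k d → ℝ} (hf : Continuous f) :
    ∫ Q, f Q ∂(grassmannMeasure hkd) = ∫ U, f (conj U (coordProj hkd)) ∂(haarO d) :=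
  integral_map (continuous_conj _).measurable.aemeasurable hf.aestronglyMeasurable

theorem integrable_grassmannMeasure (hkd : k ≤ d) {f : Grassmannian k d → ℝ} (hf : Continuous f) :
    Integrable f (grassmannMeasure hkd) :=
  (integrable_map_measure hf.aestronglyMeasurable (continuous_conj _).measurable.aemeasurable).mpr
    (integrable_haarO (hf.comp (continuous_conj _)))

instance (hkd : k ≤ d) : IsProbabilityMeasure (grassmannMeasure hkd) :=
  Measure.isProbabilityMeasure_map (continuous_conj _).measurable.aemeasurable

/-- The measure `σ_{k,d}` is invariant under the orthogonal group. -/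
theorem integral_conj (hkd : k ≤ d) (V : Matrix.orthogonalGroup (Fin d) ℝ)
    {f : Grassmannian k d → ℝ} (hf : Continuous f) :
    ∫ Q, f (conj V Q) ∂(grassmannMeasure hkd) = ∫ Q, f Q ∂(grassmannMeasure hkd) := by
  refine (integral_grassmannMeasure hkd (hf.comp (continuous_conj_right V))).trans ?_
  rw [integral_grassmannMeasure hkd hf,
    ← integral_mul_left_eq_self (fun U => f (conj U (coordProj hkd))) V]
  simp only [conj_mul, Function.comp_apply]

/-- A continuous nonnegative function that is positive at `coordProj` has a positive integral. -/
theorem integral_grassmannMeasure_pos (hkd : k ≤ d) {f : Grassmannian k d → ℝ} (hf : Continuous f)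
    (h0 : ∀ Q, 0 ≤ f Q) (h1 : f (coordProj hkd) ≠ 0) : 0 < ∫ Q, f Q ∂(grassmannMeasure hkd) := by
  rw [integral_grassmannMeasure hkd hf]
  refine Continuous.integral_pos_of_hasCompactSupport_nonneg_nonzero (x := 1)
    (hf.comp (continuous_conj _)) (HasCompactSupport.of_compactSpace _) (fun U => h0 _) ?_
  simpa [conj_one] using h1

end MomentFusion
namespace MomentFusion

variable {k d : ℕ}

/-! ### The tensor power feature map -/

/-- The feature map `Q ↦ Q^{⊗ t}` of the kernel `K_t`. -/
noncomputable def feature (t : ℕ) (Q : Grassmannian k d) : EuclideanSpace ℝ (Fin t → Fin d × Fin d) :=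
  WithLp.toLp 2 fun m => ∏ r, Q.mat (m r).1 (m r).2

theorem trInner_eq_sum (M : Matrix (Fin d) (Fin d) ℝ) (Q : Grassmannian k d) :
    trInner M Q.mat = ∑ ij : Fin d × Fin d, M ij.1 ij.2 * Q.mat ij.1 ij.2 := by
  rw [trInner, Matrix.trace, Fintype.sum_prod_type]
  refine Finset.sum_congr rfl fun i _ => ?_
  rw [Matrix.diag_apply, Matrix.mul_apply]
  refine Finset.sum_congr rfl fun j _ => ?_
  rw [show Q.mat j i = Q.mat i j from Q.2.1.apply i j]

theorem inner_feature (t : ℕ) (P Q : Grassmannian k d) :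
    inner ℝ (feature t P) (feature t Q) = kernelK t P Q := by
  rw [kernelK, trInner_eq_sum, Fintype.sum_pow, PiLp.inner_apply]
  refine Finset.sum_congr rfl fun m _ => ?_
  simp [feature, Finset.prod_mul_distrib, mul_comm]

theorem continuous_feature (t : ℕ) : Continuous (feature (k := k) (d := d) t) := by
  refine (PiLp.continuous_toLp 2 _).comp (continuous_pi fun m => ?_)
  exact continuous_finsetProd _ fun r _ => continuous_entry _ _

/-- The functions on the Grassmann space that are linear in the `t`-th tensor power. -/
noncomputable def tensorFun (t k d : ℕ) : Submodule ℝ (Grassmannian k d → ℝ) :=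
  LinearMap.range (LinearMap.pi fun Q : Grassmannian k d =>
    (innerₗ (EuclideanSpace ℝ (Fin t → Fin d × Fin d))).flip (feature t Q))

theorem mem_tensorFun {t : ℕ} {f : Grassmannian k d → ℝ} :
    f ∈ tensorFun t k d ↔
      ∃ T : EuclideanSpace ℝ (Fin t → Fin d × Fin d), f = fun Q => inner ℝ T (feature t Q) :=
  LinearMap.mem_range.trans (exists_congr fun _ => eq_comm)

theorem entry_mul_mem_tensorFun {t : ℕ} {f : Grassmannian k d → ℝ} (hf : f ∈ tensorFun t k d)
    (i j : Fin d) : (fun Q : Grassmannian k d => Q.mat i j * f Q) ∈ tensorFun (t + 1) k d := by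
  obtain ⟨T, rfl⟩ := mem_tensorFun.mp hf
  -- The tensor e_{(i,j)} ⊗ T: the new first slot selects the entry (i, j).
  refine mem_tensorFun.mpr ⟨WithLp.toLp 2 fun m => if m 0 = (i, j) then T (Fin.tail m) else 0, ?_⟩
  funext Q
  beta_reduce
  rw [PiLp.inner_apply, PiLp.inner_apply, ← (Fin.consEquiv fun _ => Fin d × Fin d).sum_comp,
    Fintype.sum_prod_type, Finset.sum_eq_single (i, j)]
  · rw [Finset.mul_sum]
    refine Finset.sum_congr rfl fun m _ => ?_
    simp [feature, Fin.prod_univ_succ, Fin.consEquiv]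
    ring
  · intro b _ hb
    simp [Fin.consEquiv, hb]
  · simp

/-- The trace is the nonzero constant k on the Grassmann space, so multiplying by trace / k raises
the degree without changing the function. Homogeneous tensors thereby capture all lower degrees. -/
theorem tensorFun_le_succ (hk : 1 ≤ k) (t : ℕ) : tensorFun t k d ≤ tensorFun (t + 1) k d := by
  intro f hf
  have hk0 : (k : ℝ) ≠ 0 := by positivity
  have : f = (k : ℝ)⁻¹ • ∑ i, fun Q : Grassmannian k d => Q.mat i i * f Q := by
    funext Q
    have htr : ∑ i, Q.mat i i = k := Q.2.2.2
    rw [Pi.smul_apply, Finset.sum_apply, ← Finset.sum_mul, htr, smul_eq_mul,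
      inv_mul_cancel_left₀ hk0]
  rw [this]
  exact Submodule.smul_mem _ _ (Submodule.sum_mem _ fun i _ => entry_mul_mem_tensorFun hf i i)

theorem tensorFun_mono (hk : 1 ≤ k) {s t : ℕ} (hst : s ≤ t) : tensorFun s k d ≤ tensorFun t k d :=
  monotone_nat_of_le_succ (tensorFun_le_succ hk) hst

theorem pow_mem_tensorFun (s : ℕ) (y : Fin d × Fin d → ℝ) :
    (fun Q : Grassmannian k d => (∑ ij, y ij * Q.mat ij.1 ij.2) ^ s) ∈ tensorFun s k d := by
  refine mem_tensorFun.mpr ⟨WithLp.toLp 2 fun m => ∏ r, y (m r), ?_⟩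
  funext Q
  rw [Fintype.sum_pow, PiLp.inner_apply]
  refine Finset.sum_congr rfl fun m _ => ?_
  simp [feature, Finset.prod_mul_distrib, mul_comm]

theorem polRank_le_tensorFun (hk : 1 ≤ k) (l t : ℕ) : PolRank l t k d ≤ tensorFun t k d := by
  refine Submodule.span_le.mpr ?_
  rintro f ⟨M, s, -, -, hs, rfl⟩
  simp only [trInner_eq_sum]
  exact tensorFun_mono hk hs (pow_mem_tensorFun s fun ij => M ij.1 ij.2)

/-- Powers of linear forms are pairings with pure tensors y^{⊗s}; polarization passes from them to
all monomials in the entries. -/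
theorem pol_subset_tensorFun (hk : 1 ≤ k) (t : ℕ) : Pol t k d ⊆ tensorFun t k d := by
  rintro f ⟨p, hp, rfl⟩
  have : (fun Q : Grassmannian k d => p.eval fun ij => Q.mat ij.1 ij.2) =
      ∑ m ∈ p.support, p.coeff m • fun Q : Grassmannian k d => ∏ ij : Fin d × Fin d, Q.mat ij.1 ij.2 ^ m ij := by
    funext Q
    rw [MvPolynomial.eval_eq', Finset.sum_apply]
    rfl
  rw [this]
  refine Submodule.sum_mem _ fun m hm => Submodule.smul_mem _ _ ?_
  have hm' : ∑ ij, m ij ≤ t := by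
    rw [← Finsupp.sum_fintype m (fun _ (n : ℕ) => n) fun _ => rfl]
    exact (MvPolynomial.le_totalDegree hm).trans hp
  exact tensorFun_mono hk hm' (monomial_mem_of_forall_pow_mem _
    (fun (Q : Grassmannian k d) (ij : Fin d × Fin d) => Q.mat ij.1 ij.2) _ (pow_mem_tensorFun _) rfl)

theorem continuous_of_mem_tensorFun {t : ℕ} {f : Grassmannian k d → ℝ}
    (hf : f ∈ tensorFun t k d) : Continuous f := by
  obtain ⟨T, rfl⟩ := mem_tensorFun.mp hf
  exact continuous_const.inner (continuous_feature t)

/-! ### Existence of cubatures -/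

/-- The mean of the feature map lies in the finite-dimensional span of its values; the coefficients
of such a representation are cubature weights, possibly negative. -/
theorem exists_isCubature (hkd : k ≤ d) (t : ℕ) :
    ∃ (n : ℕ) (P : Fin n → Grassmannian k d) (w : Fin n → ℝ),
      IsCubature hkd (tensorFun t k d) P w := by
  set b := ∫ Q, feature t Q ∂(grassmannMeasure hkd) with hb
  set W := Submodule.span ℝ (Set.range (feature (k := k) (d := d) t)) with hW
  have hint : Integrable (feature t) (grassmannMeasure hkd) := by
    refine (integrable_map_measure (continuous_feature t).aestronglyMeasurable
      (continuous_conj _).measurable.aemeasurable).mpr ?_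
    exact ((continuous_feature t).comp (continuous_conj _)).integrable_of_hasCompactSupport
      (HasCompactSupport.of_compactSpace _)
  have hbW : b ∈ W := by
    -- A vector orthogonal to all features is orthogonal to their mean, by integrating the inner
    -- product.
    rw [← Submodule.orthogonal_orthogonal W, Submodule.mem_orthogonal]
    intro T hT
    rw [hb, ← integral_inner hint]
    refine integral_eq_zero_of_ae (Filter.Eventually.of_forall fun Q => ?_)
    exact Submodule.inner_left_of_mem_orthogonal (Submodule.subset_span (Set.mem_range_self Q)) hT
  obtain ⟨n, w, g, hg⟩ := Submodule.mem_span_set'.mp hbW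
  choose P hP using fun i => (g i).2
  refine ⟨n, P, w, fun f hf => ?_⟩
  obtain ⟨T, rfl⟩ := mem_tensorFun.mp hf
  rw [integral_inner hint, ← hb, ← hg, inner_sum]
  refine Finset.sum_congr rfl fun j _ => ?_
  rw [real_inner_smul_right, ← hP]

/-! ### The kernel norm -/

/-- All T inducing the same function share their projection onto the span of the features. This
projection is the only representing vector in that span, so the infimum defining the norm is over
one value. -/
theorem kernelNorm_inner_feature (t : ℕ) (T : EuclideanSpace ℝ (Fin t → Fin d × Fin d)) :
    kernelNorm (kernelK t) (fun Q : Grassmannian k d => inner ℝ T (feature t Q)) =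
      ‖(Submodule.span ℝ (Set.range (feature (k := k) (d := d) t))).starProjection T‖ := by
  set W := Submodule.span ℝ (Set.range (feature (k := k) (d := d) t)) with hW
  have hfun : ∀ (c : Grassmannian k d →₀ ℝ) (Q : Grassmannian k d),
      (c.sum fun P a => a * kernelK t P Q) =
        inner ℝ (c.sum fun P a => a • feature t P) (feature t Q) := by
    intro c Q
    simp only [Finsupp.sum, sum_inner, real_inner_smul_left, inner_feature]
  have hnorm : ∀ c : Grassmannian k d →₀ ℝ,
      √(c.sum fun P a => c.sum fun Q b => a * b * kernelK t P Q) =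
        ‖c.sum fun P a => a • feature t P‖ := by
    intro c
    rw [norm_eq_sqrt_real_inner]
    simp only [Finsupp.sum, sum_inner, inner_sum, real_inner_smul_left, real_inner_smul_right,
      inner_feature, mul_assoc]
    rw [Finset.sum_comm]
    simp only [mul_left_comm]
  have hset : {r | ∃ c : Grassmannian k d →₀ ℝ,
      ((fun Q : Grassmannian k d => inner ℝ T (feature t Q)) =
        fun Q => c.sum fun P a => a * kernelK t P Q) ∧
      r = √(c.sum fun P a => c.sum fun Q b => a * b * kernelK t P Q)} =
      {‖W.starProjection T‖} := by
    ext r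
    simp only [Set.mem_ofPred_eq, Set.mem_singleton_iff, hfun, hnorm]
    constructor
    · rintro ⟨c, hc, rfl⟩
      congr 1
      refine (Submodule.eq_starProjection_of_mem_orthogonal
        (Finsupp.mem_span_range_iff_exists_finsupp.mpr ⟨c, rfl⟩) ?_).symm
      rw [Submodule.mem_orthogonal']
      intro u hu
      induction hu using Submodule.span_induction with
      | mem u hu =>
        obtain ⟨Q, rfl⟩ := hu
        rw [inner_sub_left, sub_eq_zero]
        exact congrFun hc Q
      | zero => exact inner_zero_right _
      | add u v _ _ hu hv => rw [inner_add_right, hu, hv, add_zero]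
      | smul a u _ hu => rw [real_inner_smul_right, hu, mul_zero]
    · rintro rfl
      obtain ⟨c, hc⟩ := Finsupp.mem_span_range_iff_exists_finsupp.mp
        (W.starProjection_apply_mem T)
      refine ⟨c, ?_, by rw [hc]⟩
      funext Q
      rw [hc]
      exact sub_eq_zero.mp ((inner_sub_left _ _ _).symm.trans
        (W.starProjection_inner_eq_zero T _ (Submodule.subset_span ⟨Q, rfl⟩)))
  rw [kernelNorm, hset, csInf_singleton]

theorem kernelNorm_nonneg {S : Type*} (K : S → S → ℝ) (f : S → ℝ) : 0 ≤ kernelNorm K f :=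
  Real.sInf_nonneg fun _ ⟨_, _, h⟩ => h ▸ Real.sqrt_nonneg _

theorem kernelNorm_smul {t : ℕ} {f : Grassmannian k d → ℝ} (hf : f ∈ tensorFun t k d) (a : ℝ) :
    kernelNorm (kernelK t) (a • f) = |a| * kernelNorm (kernelK t) f := by
  obtain ⟨T, rfl⟩ := mem_tensorFun.mp hf
  have : (a • fun Q : Grassmannian k d => (inner ℝ T (feature t Q) : ℝ)) =
      fun Q => inner ℝ (a • T) (feature t Q) := by
    funext Q
    rw [real_inner_smul_left]
    rfl
  rw [this, kernelNorm_inner_feature, kernelNorm_inner_feature, map_smul, norm_smul,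
    Real.norm_eq_abs]

theorem eq_zero_of_kernelNorm_eq_zero {t : ℕ} {f : Grassmannian k d → ℝ}
    (hf : f ∈ tensorFun t k d) (h : kernelNorm (kernelK t) f = 0) : f = 0 := by
  obtain ⟨T, rfl⟩ := mem_tensorFun.mp hf
  rw [kernelNorm_inner_feature, norm_eq_zero] at h
  funext Q
  have := Submodule.starProjection_inner_eq_zero (K := Submodule.span ℝ (Set.range
    (feature (k := k) (d := d) t))) T _ (Submodule.subset_span ⟨Q, rfl⟩)
  rwa [h, sub_zero] at this

theorem smul_mem_pol {t : ℕ} {f : Grassmannian k d → ℝ} (hf : f ∈ Pol t k d) (a : ℝ) :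
    a • f ∈ Pol t k d := by
  obtain ⟨p, hp, rfl⟩ := hf
  refine ⟨a • p, (MvPolynomial.totalDegree_smul_le a p).trans hp, ?_⟩
  funext Q
  rw [MvPolynomial.smul_eval]
  rfl

/-- The error of an approximate cubature is controlled by the kernel norm. -/
theorem IsApproxCubature.abs_error_le (hk : 1 ≤ k) {hkd : k ≤ d} {t n : ℕ} {ε : ℝ}
    {P : Fin n → Grassmannian k d} {w : Fin n → ℝ} (h : IsApproxCubature hkd t ε P w)
    {f : Grassmannian k d → ℝ} (hf : f ∈ Pol t k d) :
    |∑ j, w j * f (P j) - ∫ Q, f Q ∂(grassmannMeasure hkd)| ≤ ε * kernelNorm (kernelK t) f := by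
  have hf' := pol_subset_tensorFun hk t hf
  -- The defining bound concerns norm one only. Norm zero forces f = 0; any other f is normalized.
  rcases (kernelNorm_nonneg (kernelK t) f).eq_or_lt with h0 | h0
  · rw [← h0, eq_zero_of_kernelNorm_eq_zero hf' h0.symm]
    simp
  · set r := kernelNorm (kernelK t) f
    have h1 := h (r⁻¹ • f) (smul_mem_pol hf _)
      (by rw [kernelNorm_smul hf', abs_of_pos (inv_pos.mpr h0), inv_mul_cancel₀ h0.ne'])
    have h2 : ∑ j, w j * (r⁻¹ • f) (P j) - ∫ Q, (r⁻¹ • f) Q ∂(grassmannMeasure hkd) =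
        r⁻¹ * (∑ j, w j * f (P j) - ∫ Q, f Q ∂(grassmannMeasure hkd)) := by
      simp only [Pi.smul_apply, smul_eq_mul, integral_const_mul]
      rw [mul_sub, Finset.mul_sum]
      simp only [mul_left_comm]
    rwa [h2, abs_mul, abs_of_pos (inv_pos.mpr h0), inv_mul_le_iff₀ h0, mul_comm] at h1

end MomentFusion
namespace MomentFusion

variable {k d : ℕ}

/-! ### Moments of projected vectors -/

/-- The matrix is the symmetrization of the outer product of y and x. Symmetry of Q makes both
halves contribute equally. -/
theorem trInner_sym_vecMul (x y : Fin d → ℝ) (Q : Grassmannian k d) :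
    trInner (Matrix.of fun i j => y i / 2 * x j + x i / 2 * y j) Q.mat = y ⬝ᵥ (Q.mat *ᵥ x) := by
  have hs : ∀ i j, Q.mat i j = Q.mat j i := fun i j => Q.2.1.apply j i
  rw [trInner_eq_sum, Fintype.sum_prod_type]
  simp only [Matrix.of_apply, add_mul, Finset.sum_add_distrib]
  rw [Finset.sum_comm (f := fun i j => x i / 2 * y j * Q.mat i j), ← Finset.sum_add_distrib,
    dotProduct]
  refine Finset.sum_congr rfl fun i _ => ?_
  rw [Matrix.mulVec, dotProduct, Finset.mul_sum, ← Finset.sum_add_distrib]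
  refine Finset.sum_congr rfl fun j _ => ?_
  rw [hs j i]
  ring

theorem rank_sym_vecMul_le (x y : Fin d → ℝ) :
    (Matrix.of fun i j => y i / 2 * x j + x i / 2 * y j).rank ≤ 2 := by
  have : (Matrix.of fun i j => y i / 2 * x j + x i / 2 * y j) =
      (Matrix.of fun i (c : Fin 2) => ![y i / 2, x i / 2] c) *
        (Matrix.of fun (c : Fin 2) j => ![x j, y j] c) := by
    ext i j
    simp [Matrix.mul_apply, Fin.sum_univ_two]
  rw [this]
  exact (Matrix.rank_mul_le_left _ _).trans (Matrix.rank_le_width _)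

theorem mono_mulVec_mem_polRank {l : ℕ} (hl : 2 ≤ l) {t : ℕ} (x : Fin d → ℝ) {β : Fin d → ℕ}
    (hβ : ∑ i, β i ≤ t) :
    (fun Q : Grassmannian k d => mono (Q.mat *ᵥ x) β) ∈ PolRank l t k d := by
  refine monomial_mem_of_forall_pow_mem _ (fun (Q : Grassmannian k d) i => (Q.mat *ᵥ x) i) _
    (fun y => Submodule.subset_span (Set.mem_ofPred_eq ▸
      ⟨_, _, ?_, (rank_sym_vecMul_le x y).trans hl, hβ, ?_⟩)) rfl
  · ext i j
    simp only [Matrix.transpose_apply, Matrix.of_apply]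
    ring
  · funext Q
    rw [trInner_sym_vecMul]
    rfl

/-- Each of the |β| linear factors picks a column, recorded by p. The dependence on A and on x
separates, so constants uniform in x become available. -/
theorem mono_mulVec_eq_sum (A : Matrix (Fin d) (Fin d) ℝ) (x : Fin d → ℝ) (β : Fin d → ℕ) :
    mono (A *ᵥ x) β = ∑ p : (i : Fin d) → Fin (β i) → Fin d,
      (∏ i, ∏ r, A i (p i r)) * ∏ i, ∏ r, x (p i r) := by
  simp only [mono, Matrix.mulVec, dotProduct, Fintype.sum_pow]
  rw [Finset.prod_univ_sum, Fintype.piFinset_univ]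
  simp only [Finset.prod_mul_distrib]

theorem abs_prod_prod_le (x : EuclideanSpace ℝ (Fin d)) (β : Fin d → ℕ)
    (p : (i : Fin d) → Fin (β i) → Fin d) :
    |∏ i, ∏ r, x.ofLp (p i r)| ≤ ‖x‖ ^ ∑ i, β i := by
  rw [Finset.abs_prod, ← Finset.prod_pow_eq_pow_sum]
  refine Finset.prod_le_prod (fun _ _ => abs_nonneg _) fun i _ => ?_
  rw [Finset.abs_prod]
  refine (Finset.prod_le_prod (fun _ _ => abs_nonneg _)
    fun r _ => (PiLp.norm_apply_le x (p i r) : |_| ≤ ‖x‖)).trans ?_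
  simp

theorem abs_mono_mulVec_le (A : Matrix (Fin d) (Fin d) ℝ) (x : EuclideanSpace ℝ (Fin d))
    (β : Fin d → ℕ) : |mono (A *ᵥ x.ofLp) β| ≤
      (∑ p : (i : Fin d) → Fin (β i) → Fin d, |∏ i, ∏ r, A i (p i r)|) * ‖x‖ ^ ∑ i, β i := by
  rw [mono_mulVec_eq_sum, Finset.sum_mul]
  refine (Finset.abs_sum_le_sum_abs _ _).trans (Finset.sum_le_sum fun p _ => ?_)
  rw [abs_mul]
  exact mul_le_mul_of_nonneg_left (abs_prod_prod_le x β p) (abs_nonneg _)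

theorem continuous_mono_mulVec_right (A : Matrix (Fin d) (Fin d) ℝ) (β : Fin d → ℕ) :
    Continuous fun x : EuclideanSpace ℝ (Fin d) => mono (A *ᵥ x.ofLp) β := by
  refine continuous_finsetProd _ fun i _ => Continuous.pow ?_ _
  exact (continuous_apply i).comp
    (Continuous.matrix_mulVec continuous_const (PiLp.continuous_ofLp 2 _))

/-! ### From pointwise estimates to moments of random vectors -/

section RandomVectors

variable {Ω : Type*} [MeasurableSpace Ω] {μ : Measure Ω} {X : Ω → EuclideanSpace ℝ (Fin d)}

theorem integrable_mono_mulVec (hX : AEMeasurable X μ) (A : Matrix (Fin d) (Fin d) ℝ)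
    {β : Fin d → ℕ} (h : Integrable (fun ω => ‖X ω‖ ^ ∑ i, β i) μ) :
    Integrable (fun ω => mono (A *ᵥ (X ω).ofLp) β) μ :=
  (h.const_mul _).mono'
    ((continuous_mono_mulVec_right A β).measurable.comp_aemeasurable hX).aestronglyMeasurable
    (Filter.Eventually.of_forall fun ω => abs_mono_mulVec_le A (X ω) β)

theorem integrable_mono (hX : AEMeasurable X μ) {β : Fin d → ℕ}
    (h : Integrable (fun ω => ‖X ω‖ ^ ∑ i, β i) μ) :
    Integrable (fun ω => mono (X ω).ofLp β) μ := by
  simpa using integrable_mono_mulVec hX 1 h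

/-- A pointwise reconstruction estimate gives an estimate of the moments. -/
theorem abs_moment_sub_fusedMoment_le {n : ℕ} {B : Finset (Fin d → ℕ)} {a : (Fin d → ℕ) → ℝ}
    {P : Fin n → Grassmannian k d} {w : Fin n → ℝ} {t : ℕ} {α : Fin d → ℕ} (hα : ∑ i, α i = t)
    (hX : AEMeasurable X μ) (ht : Integrable (fun ω => ‖X ω‖ ^ t) μ)
    (hB : ∀ β ∈ B, Integrable (fun ω => ‖X ω‖ ^ ∑ i, β i) μ) (C : ℝ)
    (h : ∀ᵐ ω ∂μ, |mono (X ω).ofLp α -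
      ∑ β ∈ B, a β * ∑ j, w j * mono ((P j).mat *ᵥ (X ω).ofLp) β| ≤ C * ‖X ω‖ ^ t) :
    |∫ ω, mono (X ω).ofLp α ∂μ - fusedMoment B a P w μ X| ≤ C * ∫ ω, ‖X ω‖ ^ t ∂μ := by
  subst hα
  have hj : ∀ β ∈ B, ∀ j ∈ Finset.univ,
      Integrable (fun ω => w j * mono ((P j).mat *ᵥ (X ω).ofLp) β) μ := fun β hβ j _ =>
    (integrable_mono_mulVec hX _ (hB β hβ)).const_mul _
  have hβ : ∀ β ∈ B, Integrable
      (fun ω => a β * ∑ j, w j * mono ((P j).mat *ᵥ (X ω).ofLp) β) μ := fun β hβ =>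
    (integrable_finsetSum _ (hj β hβ)).const_mul _
  have hf : fusedMoment B a P w μ X =
      ∫ ω, ∑ β ∈ B, a β * ∑ j, w j * mono ((P j).mat *ᵥ (X ω).ofLp) β ∂μ := by
    rw [integral_finsetSum _ hβ, fusedMoment]
    refine Finset.sum_congr rfl fun β hβ' => ?_
    rw [integral_const_mul, integral_finsetSum _ (hj β hβ')]
    simp only [integral_const_mul]
  rw [hf, ← integral_sub (integrable_mono hX ht) (integrable_finsetSum _ hβ),
    ← integral_const_mul]
  exact norm_integral_le_of_norm_le (ht.const_mul C)
    (h.mono fun ω hω => (Real.norm_eq_abs _).trans_le hω)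

theorem integrable_norm_pow_of_norm_eq_one [IsFiniteMeasure μ] (h : ∀ᵐ ω ∂μ, ‖X ω‖ = 1) (s : ℕ) :
    Integrable (fun ω => ‖X ω‖ ^ s) μ :=
  (integrable_const (1 : ℝ)).congr (h.mono fun ω hω => by simp [hω])

end RandomVectors

/-! ### Exact reconstruction -/

/-- Exact reconstruction of the moments from a pointwise identity. -/
theorem moment_eq_fusedMoment {hkd : k ≤ d} {l t n : ℕ} (hl : 2 ≤ l) {α : Fin d → ℕ}
    (hα : ∑ i, α i = t) {B : Finset (Fin d → ℕ)} (hB : ∀ β ∈ B, ∑ i, β i ≤ t)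
    {a : (Fin d → ℕ) → ℝ} {P : Fin n → Grassmannian k d} {w : Fin n → ℝ}
    (hP : IsCubature hkd (PolRank l t k d) P w)
    {Ω : Type*} [MeasurableSpace Ω] {μ : Measure Ω} {X : Ω → EuclideanSpace ℝ (Fin d)}
    (hX : AEMeasurable X μ) (ht : Integrable (fun ω => ‖X ω‖ ^ t) μ)
    (hBX : ∀ β ∈ B, Integrable (fun ω => ‖X ω‖ ^ ∑ i, β i) μ)
    (h : ∀ᵐ ω ∂μ, mono (X ω).ofLp α =
      ∑ β ∈ B, a β * ∫ Q : Grassmannian k d, mono (Q.mat *ᵥ (X ω).ofLp) β ∂(grassmannMeasure hkd)) :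
    ∫ ω, mono (X ω).ofLp α ∂μ = fusedMoment B a P w μ X := by
  -- The estimate with constant 0 is an identity.
  have := abs_moment_sub_fusedMoment_le (a := a) (P := P) (w := w) hα hX ht hBX 0 <| by
    filter_upwards [h] with ω hω
    rw [zero_mul, hω, abs_nonpos_iff, sub_eq_zero]
    refine Finset.sum_congr rfl fun β hβ => ?_
    rw [hP _ (mono_mulVec_mem_polRank hl (X ω).ofLp (hB β hβ))]
  rwa [zero_mul, abs_nonpos_iff, sub_eq_zero] at this

/-- Coefficients that reconstruct the moments of deterministic vectors satisfy the pointwise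
identity. -/
theorem mono_eq_sum_of_forall_fusedMoment (hk : 1 ≤ k) (hkd : k ≤ d) {l t : ℕ} {α : Fin d → ℕ}
    {B : Finset (Fin d → ℕ)} (hB : ∀ β ∈ B, ∑ i, β i ≤ t) {a : (Fin d → ℕ) → ℝ}
    {x : EuclideanSpace ℝ (Fin d)}
    (h : ∀ (n : ℕ) (P : Fin n → Grassmannian k d) (w : Fin n → ℝ),
      IsCubature hkd (PolRank l t k d) P w →
      ∫ _ : PUnit.{u + 1}, mono x.ofLp α ∂(Measure.dirac PUnit.unit) =
        fusedMoment B a P w (Measure.dirac PUnit.unit) fun _ : PUnit.{u + 1} => x) :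
    mono x.ofLp α =
      ∑ β ∈ B, a β * ∫ Q : Grassmannian k d, mono (Q.mat *ᵥ x.ofLp) β ∂(grassmannMeasure hkd) := by
  -- Without an actual cubature the hypothesis would be vacuous. One that is exact on `tensorFun`
  -- serves every rank bound l at once.
  obtain ⟨n, P, w, hP⟩ := exists_isCubature hkd t
  have h1 := h n P w fun f hf => hP f (polRank_le_tensorFun hk l t hf)
  rw [integral_dirac] at h1
  rw [h1, fusedMoment]
  refine Finset.sum_congr rfl fun β hβ => ?_
  rw [← hP _ (polRank_le_tensorFun hk 2 t (mono_mulVec_mem_polRank le_rfl x.ofLp (hB β hβ)))]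
  simp only [integral_dirac]

/-! ### Approximate reconstruction -/

theorem prod_entries_mem_pol {t : ℕ} {β : Fin d → ℕ} (hβ : ∑ i, β i ≤ t)
    (p : (i : Fin d) → Fin (β i) → Fin d) :
    (fun Q : Grassmannian k d => ∏ i, ∏ r, Q.mat i (p i r)) ∈ Pol t k d := by
  refine ⟨∏ i, ∏ r, MvPolynomial.X (i, p i r), le_trans ?_ hβ, ?_⟩
  · refine (MvPolynomial.totalDegree_finsetProd _ _).trans (Finset.sum_le_sum fun i _ => ?_)
    refine (MvPolynomial.totalDegree_finsetProd _ _).trans ?_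
    simp
  · funext Q
    simp [map_prod]

/-- The error splits into errors of products of entries, which do not involve x, weighted by
monomials of degree |β| in x. Summing the kernel norms of these products gives a constant
independent of x, ε and the cubature. -/
theorem exists_abs_error_mono_le (hk : 1 ≤ k) (hkd : k ≤ d) {t : ℕ} {β : Fin d → ℕ}
    (hβ : ∑ i, β i ≤ t) : ∃ C : ℝ, ∀ (ε : ℝ) (n : ℕ) (P : Fin n → Grassmannian k d) (w : Fin n → ℝ),
      IsApproxCubature hkd t ε P w → ∀ x : EuclideanSpace ℝ (Fin d),
        |∑ j, w j * mono ((P j).mat *ᵥ x.ofLp) β -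
          ∫ Q : Grassmannian k d, mono (Q.mat *ᵥ x.ofLp) β ∂(grassmannMeasure hkd)| ≤
        C * ε * ‖x‖ ^ ∑ i, β i := by
  set h : ((i : Fin d) → Fin (β i) → Fin d) → Grassmannian k d → ℝ :=
    fun p Q => ∏ i, ∏ r, Q.mat i (p i r) with hh
  have hpol : ∀ p, h p ∈ Pol t k d := prod_entries_mem_pol hβ
  refine ⟨∑ p, kernelNorm (kernelK t) (h p), fun ε n P w hP x => ?_⟩
  have herr := fun p => hP.abs_error_le hk (hpol p)
  have hint : ∀ p ∈ Finset.univ, Integrable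
      (fun Q => h p Q * ∏ i, ∏ r, x.ofLp (p i r)) (grassmannMeasure hkd) := fun p _ =>
    (integrable_grassmannMeasure hkd
      (continuous_of_mem_tensorFun (pol_subset_tensorFun hk t (hpol p)))).mul_const _
  have hsum : ∑ j, w j * mono ((P j).mat *ᵥ x.ofLp) β -
      ∫ Q : Grassmannian k d, mono (Q.mat *ᵥ x.ofLp) β ∂(grassmannMeasure hkd) =
      ∑ p, (∑ j, w j * h p (P j) - ∫ Q, h p Q ∂(grassmannMeasure hkd)) *
        ∏ i, ∏ r, x.ofLp (p i r) := by
    simp only [mono_mulVec_eq_sum, sub_mul, Finset.sum_sub_distrib]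
    rw [integral_finsetSum _ hint]
    simp only [integral_mul_const, Finset.mul_sum, Finset.sum_mul, mul_assoc]
    rw [Finset.sum_comm]
  rw [hsum, Finset.sum_mul, Finset.sum_mul]
  refine (Finset.abs_sum_le_sum_abs _ _).trans (Finset.sum_le_sum fun p _ => ?_)
  rw [abs_mul]
  refine mul_le_mul ((herr p).trans_eq (mul_comm _ _)) (abs_prod_prod_le x β p) (abs_nonneg _) ?_
  -- The sign of ε is not prescribed; ε times the norm is nonnegative because it bounds an absolute
  -- value.
  rw [mul_comm]
  exact (abs_nonneg _).trans (herr p)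

/-- Approximate reconstruction of the moments from a pointwise identity. -/
theorem exists_abs_moment_sub_fusedMoment_le (hk : 1 ≤ k) (hkd : k ≤ d) {t : ℕ} {α : Fin d → ℕ}
    (hα : ∑ i, α i = t) {B : Finset (Fin d → ℕ)} {S : Set (EuclideanSpace ℝ (Fin d))}
    (hB : ∀ β ∈ B, ∑ i, β i ≤ t) (hS : ∀ β ∈ B, ∀ x ∈ S, ‖x‖ ^ ∑ i, β i = ‖x‖ ^ t)
    {a : (Fin d → ℕ) → ℝ} (ha : ∀ x ∈ S, mono x.ofLp α =
      ∑ β ∈ B, a β * ∫ Q : Grassmannian k d, mono (Q.mat *ᵥ x.ofLp) β ∂(grassmannMeasure hkd)) :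
    ∃ c : ℝ, ∀ (ε : ℝ) (n : ℕ) (P : Fin n → Grassmannian k d) (w : Fin n → ℝ),
      IsApproxCubature hkd t ε P w →
      ∀ (Ω : Type u) [MeasurableSpace Ω] (μ : Measure Ω) (X : Ω → EuclideanSpace ℝ (Fin d)),
        AEMeasurable X μ → (∀ᵐ ω ∂μ, X ω ∈ S) → Integrable (fun ω => ‖X ω‖ ^ t) μ →
        |∫ ω, mono (X ω).ofLp α ∂μ - fusedMoment B a P w μ X| ≤
          c * (ε * ∫ ω, ‖X ω‖ ^ t ∂μ) := by
  have hC : ∀ β : Fin d → ℕ, ∃ C : ℝ, β ∈ B → ∀ (ε : ℝ) (n : ℕ) (P : Fin n → Grassmannian k d)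
      (w : Fin n → ℝ), IsApproxCubature hkd t ε P w → ∀ x : EuclideanSpace ℝ (Fin d),
        |∑ j, w j * mono ((P j).mat *ᵥ x.ofLp) β -
          ∫ Q : Grassmannian k d, mono (Q.mat *ᵥ x.ofLp) β ∂(grassmannMeasure hkd)| ≤
        C * ε * ‖x‖ ^ ∑ i, β i := by
    intro β
    by_cases hβ : β ∈ B
    · obtain ⟨C, hC⟩ := exists_abs_error_mono_le hk hkd (hB β hβ)
      exact ⟨C, fun _ => hC⟩
    · exact ⟨0, fun h => absurd h hβ⟩
  choose C hC using hC
  refine ⟨∑ β ∈ B, |a β| * C β, fun ε n P w hP Ω _ μ X hX hXS ht => ?_⟩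
  rw [← mul_assoc]
  refine abs_moment_sub_fusedMoment_le hα hX ht
    (fun β hβ => ht.congr (hXS.mono fun ω hω => (hS β hβ _ hω).symm)) _ ?_
  filter_upwards [hXS] with ω hω
  rw [ha _ hω, ← Finset.sum_sub_distrib, Finset.sum_mul, Finset.sum_mul]
  refine (Finset.abs_sum_le_sum_abs _ _).trans (Finset.sum_le_sum fun β hβ => ?_)
  rw [← mul_sub, abs_mul, abs_sub_comm, mul_assoc, mul_assoc]
  refine mul_le_mul_of_nonneg_left ?_ (abs_nonneg _)
  -- On S all occurring powers of the norm agree, so the bounds for different β share the factor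
  -- ‖x‖^t.
  rw [← mul_assoc, ← hS β hβ _ hω]
  exact hC β hβ ε n P w hP (X ω)

end MomentFusion
namespace MomentFusion

variable {k d : ℕ}

/-! ### Orthogonal frames and quadratic forms of projections -/

/-- A pairwise orthogonal family of vectors consists of multiples of the rows of an orthogonal
matrix. -/
theorem exists_orthogonal_rows (f : Fin d → EuclideanSpace ℝ (Fin d))
    (hf : Pairwise fun i j => (inner ℝ (f i) (f j) : ℝ) = 0) :
    ∃ U : Matrix.orthogonalGroup (Fin d) ℝ, ∀ i, (f i).ofLp = ‖f i‖ • U.1 i := by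
  -- On an orthogonal family Gram–Schmidt only normalizes the nonzero vectors; the places of zero
  -- vectors are filled to complete a basis.
  set b := InnerProductSpace.gramSchmidtOrthonormalBasis (𝕜 := ℝ)
    (finrank_euclideanSpace (𝕜 := ℝ) (ι := Fin d)) f with hb
  refine ⟨⟨Matrix.of fun i => (b i).ofLp, ?_⟩, fun i => ?_⟩
  · rw [Matrix.mem_orthogonalGroup_iff]
    ext i j
    have h := orthonormal_iff_ite.mp b.orthonormal j i
    rw [EuclideanSpace.inner_eq_star_dotProduct] at h
    rw [Matrix.mul_apply, Matrix.one_apply]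
    simp only [dotProduct, Pi.star_apply, star_trivial] at h
    simp only [Matrix.transpose_apply, Matrix.of_apply, h, eq_comm]
  · by_cases h0 : f i = 0
    · simp [h0]
    · change _ = ‖f i‖ • (b i).ofLp
      rw [hb, InnerProductSpace.gramSchmidtOrthonormalBasis_apply_of_orthogonal _ hf h0]
      have : ‖f i‖ ≠ 0 := norm_ne_zero_iff.mpr h0
      ext j
      simp [mul_inv_cancel_left₀ this]

theorem conj_mat_apply (U : Matrix.orthogonalGroup (Fin d) ℝ) (Q : Grassmannian k d) (i j : Fin d) :
    (conj U Q).mat i j = U.1 i ⬝ᵥ (Q.mat *ᵥ U.1 j) :=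
  Matrix.mul_mul_apply _ _ _ _ _

theorem dotProduct_mulVec_comm (Q : Grassmannian k d) (x y : Fin d → ℝ) :
    x ⬝ᵥ (Q.mat *ᵥ y) = y ⬝ᵥ (Q.mat *ᵥ x) := by
  rw [Matrix.dotProduct_mulVec, dotProduct_comm, ← Matrix.mulVec_transpose,
    show Q.matᵀ = Q.mat from Q.2.1]

theorem smul_dotProduct_mulVec_smul (Q : Grassmannian k d) (p : ℝ) (x : Fin d → ℝ) :
    (p • x) ⬝ᵥ (Q.mat *ᵥ (p • x)) = p ^ 2 * (x ⬝ᵥ (Q.mat *ᵥ x)) := by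
  rw [Matrix.mulVec_smul, smul_dotProduct, dotProduct_smul, smul_eq_mul, smul_eq_mul]
  ring

theorem mat_diag_nonneg (Q : Grassmannian k d) (i : Fin d) : 0 ≤ Q.mat i i := by
  have h : (Q.mat * Q.mat) i i = Q.mat i i := congrFun (congrFun Q.2.2.1 i) i
  rw [← h, Matrix.mul_apply]
  refine Finset.sum_nonneg fun j _ => ?_
  rw [show Q.mat j i = Q.mat i j from Q.2.1.apply i j]
  exact mul_self_nonneg _

/-- The bilinear form of a projection at two unit vectors is expressed by diagonal entries in a
suitable orthonormal basis. -/
theorem exists_dotProduct_mulVec_eq {i₀ i₁ : Fin d} (h01 : i₀ ≠ i₁)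
    {x y : EuclideanSpace ℝ (Fin d)} (hx : ‖x‖ = 1) (hy : ‖y‖ = 1) :
    ∃ U : Matrix.orthogonalGroup (Fin d) ℝ, ∀ Q : Grassmannian k d,
      y.ofLp ⬝ᵥ (Q.mat *ᵥ x.ofLp) =
        inner ℝ x y * (((conj U Q).mat i₀ i₀ + (conj U Q).mat i₁ i₁) / 2) +
          ((conj U Q).mat i₀ i₀ - (conj U Q).mat i₁ i₁) / 2 := by
  have horth : (inner ℝ (x + y) (x - y) : ℝ) = 0 := by
    rw [inner_add_left, inner_sub_right, inner_sub_right, real_inner_self_eq_norm_sq,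
      real_inner_self_eq_norm_sq, hx, hy, real_inner_comm x y]
    ring
  -- The zero entries leave the other rows free, and the cases x = y and x = -y need no separate
  -- treatment.
  obtain ⟨U, hU⟩ := exists_orthogonal_rows
    (fun i : Fin d => if i = i₀ then x + y else if i = i₁ then x - y else 0) <| by
    intro i j hij
    by_cases hi : i = i₀
    · subst hi
      by_cases hj : j = i₁
      · subst hj
        simp [hij.symm, horth]
      · simp [hij.symm, hj]
    · by_cases hi' : i = i₁
      · subst hi'
        by_cases hj : j = i₀
        · subst hj
          simp [hi, real_inner_comm, horth]
        · simp [hj, hij.symm]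
      · simp [hi, hi']
  refine ⟨U, fun Q => ?_⟩
  have hp := hU i₀
  have hq := hU i₁
  simp only [if_true, h01.symm, if_false, WithLp.ofLp_add, WithLp.ofLp_sub] at hp hq
  -- Polarization 4 y⬝Qx = (x+y)⬝Q(x+y) - (x-y)⬝Q(x-y), combined with ‖x ± y‖² = 2 ± 2⟨x, y⟩.
  have h0 := smul_dotProduct_mulVec_smul Q ‖x + y‖ (U.1 i₀)
  have h1 := smul_dotProduct_mulVec_smul Q ‖x - y‖ (U.1 i₁)
  rw [← hp, ← conj_mat_apply, norm_add_sq_real, hx, hy, Matrix.mulVec_add, add_dotProduct,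
    dotProduct_add, dotProduct_add, dotProduct_mulVec_comm Q x.ofLp y.ofLp] at h0
  rw [← hq, ← conj_mat_apply, norm_sub_sq_real, hx, hy, Matrix.mulVec_sub, sub_dotProduct,
    dotProduct_sub, dotProduct_sub, dotProduct_mulVec_comm Q x.ofLp y.ofLp] at h1
  linarith

/-- Settles dimension one, where a second diagonal entry does not exist. -/
theorem mat_eq_one_of_subsingleton [Subsingleton (Fin d)] (hk : 1 ≤ k) (hkd : k ≤ d)
    (Q : Grassmannian k d) : Q.mat = 1 := by
  have hd : d ≤ 1 := Fin.subsingleton_iff_le_one.mp inferInstance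
  obtain rfl : d = 1 := by omega
  obtain rfl : k = 1 := by omega
  have h : Q.mat.trace = (1 : ℕ) := Q.2.2.2
  ext i j
  rw [Subsingleton.elim i 0, Subsingleton.elim j 0]
  simpa [Matrix.trace] using h

/-- The moments of the bilinear form of a random projection at two unit vectors are polynomials in
their inner product, with nonvanishing leading coefficient. -/
theorem exists_integral_dotProduct_pow (hk : 1 ≤ k) (hkd : k ≤ d) (m : ℕ) :
    ∃ c : ℕ → ℝ, c m ≠ 0 ∧ ∀ x y : EuclideanSpace ℝ (Fin d), ‖x‖ = 1 → ‖y‖ = 1 →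
      ∫ Q : Grassmannian k d, (y.ofLp ⬝ᵥ (Q.mat *ᵥ x.ofLp)) ^ m ∂(grassmannMeasure hkd) =
        ∑ i ∈ Finset.range (m + 1), c i * (inner ℝ x y : ℝ) ^ i := by
  rcases subsingleton_or_nontrivial (Fin d) with hsub | hnt
  · refine ⟨fun i => if i = m then 1 else 0, by simp, fun x y _ _ => ?_⟩
    simp only [mat_eq_one_of_subsingleton hk hkd, Matrix.one_mulVec, integral_const]
    simp [EuclideanSpace.inner_eq_star_dotProduct]
  · have hd : 0 < d := hk.trans hkd
    set i₀ : Fin d := ⟨0, hd⟩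
    obtain ⟨i₁, h01⟩ := exists_ne i₀
    set τ : Grassmannian k d → ℝ := fun Q => (Q.mat i₀ i₀ + Q.mat i₁ i₁) / 2 with hτ
    set ζ : Grassmannian k d → ℝ := fun Q => (Q.mat i₀ i₀ - Q.mat i₁ i₁) / 2 with hζ
    have cτ : Continuous τ := ((continuous_entry _ _).add (continuous_entry _ _)).div_const _
    have cζ : Continuous ζ := ((continuous_entry _ _).sub (continuous_entry _ _)).div_const _
    -- After a rotation y⬝Qx becomes ⟨x, y⟩ τ + ζ with τ, ζ independent of x and y. These are the
    -- binomial coefficients of its m-th moment; the top one is ∫ τ^m, positive since τ ≥ 0 and τ >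
    -- 0 at `coordProj`.
    refine ⟨fun i => m.choose i * ∫ Q, τ Q ^ i * ζ Q ^ (m - i) ∂(grassmannMeasure hkd), ?_,
      fun x y hx hy => ?_⟩
    · simp only [Nat.choose_self, Nat.cast_one, one_mul, Nat.sub_self, pow_zero, mul_one]
      have hτ0 : ∀ Q, 0 ≤ τ Q := fun Q =>
        div_nonneg (add_nonneg (mat_diag_nonneg Q _) (mat_diag_nonneg Q _)) zero_le_two
      refine (integral_grassmannMeasure_pos hkd (cτ.pow m) (fun Q => pow_nonneg (hτ0 Q) m)
        (pow_ne_zero m ?_)).ne'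
      have h0 : (coordProj hkd).mat i₀ i₀ = 1 := by
        have : 0 < k := hk
        simp [coordProj, Grassmannian.mat, i₀, this]
      have h1 := mat_diag_nonneg (coordProj hkd) i₁
      simp only [hτ, h0]
      positivity
    · obtain ⟨U, hU⟩ := exists_dotProduct_mulVec_eq (k := k) h01.symm hx hy
      simp only [hU]
      have hc : Continuous fun Q => (inner ℝ x y * τ Q + ζ Q) ^ m :=
        ((continuous_const.mul cτ).add cζ).pow m
      refine (integral_conj hkd U hc).trans ?_
      simp only [add_pow]
      rw [integral_finsetSum]
      swap
      · exact fun i _ => integrable_grassmannMeasure hkd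
          ((((continuous_const.mul cτ).pow i).mul (cζ.pow _)).mul continuous_const)
      refine Finset.sum_congr rfl fun i _ => ?_
      rw [← integral_const_mul, ← integral_mul_const]
      refine integral_congr_ae (Filter.Eventually.of_forall fun Q => ?_)
      beta_reduce
      rw [mul_pow]
      ring

/-! ### Existence of the coefficients -/

theorem exists_sum_smul_of_mem_span {ι M : Type*} [AddCommGroup M] [Module ℝ M] {B : Finset ι}
    {v : ι → M} {x : M} (h : x ∈ Submodule.span ℝ (v '' ↑B)) :
    ∃ a : ι → ℝ, ∑ i ∈ B, a i • v i = x := by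
  classical
  obtain ⟨c, hc⟩ := (Submodule.mem_span_image_finset_iff_exists_fun ℝ).mp h
  refine ⟨fun i => if h : i ∈ B then c ⟨i, h⟩ else 0, ?_⟩
  rw [← hc, ← Finset.sum_coe_sort]
  simp

theorem mem_indexEq {t : ℕ} {β : Fin d → ℕ} : β ∈ indexEq d t ↔ ∑ i, β i = t := by
  simp [indexEq]

theorem mem_indexLE {t : ℕ} {β : Fin d → ℕ} : β ∈ indexLE d t ↔ ∑ i, β i ≤ t := by
  simp [indexLE, mem_indexEq]

/-- On the unit sphere, the monomials of degree `t` are combinations of the averaged monomials of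
degree at most `t`. -/
theorem exists_mono_eq_sum_sphere (hk : 1 ≤ k) (hkd : k ≤ d) {t : ℕ} {α : Fin d → ℕ}
    (hα : ∑ i, α i = t) : ∃ a : (Fin d → ℕ) → ℝ, ∀ x : EuclideanSpace ℝ (Fin d), ‖x‖ = 1 →
      mono x.ofLp α = ∑ β ∈ indexLE d t,
        a β * ∫ Q : Grassmannian k d, mono (Q.mat *ᵥ x.ofLp) β ∂(grassmannMeasure hkd) := by
  set F : (Fin d → ℕ) → {x : EuclideanSpace ℝ (Fin d) // ‖x‖ = 1} → ℝ := fun β x =>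
    ∫ Q : Grassmannian k d, mono (Q.mat *ᵥ x.1.ofLp) β ∂(grassmannMeasure hkd) with hF
  set W := Submodule.span ℝ (F '' ↑(indexLE d t)) with hW
  have hpow : ∀ s ≤ t, ∀ y : Fin d → ℝ, (fun x : {x : EuclideanSpace ℝ (Fin d) // ‖x‖ = 1} =>
      ∫ Q : Grassmannian k d, (y ⬝ᵥ (Q.mat *ᵥ x.1.ofLp)) ^ s ∂(grassmannMeasure hkd)) ∈ W := by
    intro s hs y
    have : (fun x : {x : EuclideanSpace ℝ (Fin d) // ‖x‖ = 1} =>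
        ∫ Q : Grassmannian k d, (y ⬝ᵥ (Q.mat *ᵥ x.1.ofLp)) ^ s ∂(grassmannMeasure hkd)) =
        ∑ β ∈ indexEq d s, (Nat.multinomial Finset.univ β * ∏ i, y i ^ β i : ℝ) • F β := by
      funext x
      simp only [dotProduct, Finset.sum_pow_eq_sum_piAntidiag, mul_pow, Finset.prod_mul_distrib,
        ← mul_assoc]
      rw [integral_finsetSum, Finset.sum_apply]
      swap
      · exact fun β _ => integrable_grassmannMeasure hkd
          (continuous_const.mul (continuous_mono_mulVec x.1.ofLp β))
      exact Finset.sum_congr rfl fun β _ => integral_const_mul _ _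
    rw [this]
    exact Submodule.sum_mem _ fun β hβ => Submodule.smul_mem _ _ (Submodule.subset_span
      ⟨β, mem_indexLE.mpr ((mem_indexEq.mp hβ).trans_le hs), rfl⟩)
  have hunit : ∀ s ≤ t, ∀ y : EuclideanSpace ℝ (Fin d), ‖y‖ = 1 →
      (fun x : {x : EuclideanSpace ℝ (Fin d) // ‖x‖ = 1} => (inner ℝ x.1 y : ℝ) ^ s) ∈ W := by
    intro s
    induction s using Nat.strong_induction_on with
    | _ s ih =>
      intro hs y hy
      -- The triangular step: solve for ⟨x, y⟩^s, the lower powers being in W by induction. Odd and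
      -- even powers may both occur, hence all |β| ≤ t.
      obtain ⟨c, hc0, hc⟩ := exists_integral_dotProduct_pow hk hkd s
      have h1 : (fun x : {x : EuclideanSpace ℝ (Fin d) // ‖x‖ = 1} => (inner ℝ x.1 y : ℝ) ^ s) =
          (c s)⁻¹ • ((fun x => ∫ Q : Grassmannian k d,
            (y.ofLp ⬝ᵥ (Q.mat *ᵥ x.1.ofLp)) ^ s ∂(grassmannMeasure hkd)) -
            ∑ i ∈ Finset.range s, c i • fun x => (inner ℝ x.1 y : ℝ) ^ i) := by
        funext x
        simp only [Pi.smul_apply, Pi.sub_apply, Finset.sum_apply, smul_eq_mul, hc x.1 y x.2 hy,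
          Finset.sum_range_succ]
        rw [add_sub_cancel_left, inv_mul_cancel_left₀ hc0]
      rw [h1]
      refine Submodule.smul_mem _ _ (Submodule.sub_mem _ (hpow s hs _)
        (Submodule.sum_mem _ fun i hi => Submodule.smul_mem _ _ ?_))
      have hi' := Finset.mem_range.mp hi
      exact ih i hi' (hi'.le.trans hs) y hy
  have hall : ∀ y : Fin d → ℝ, (fun x : {x : EuclideanSpace ℝ (Fin d) // ‖x‖ = 1} =>
      (∑ i, y i * x.1.ofLp i) ^ t) ∈ W := by
    intro y
    have : Nontrivial (EuclideanSpace ℝ (Fin d)) := by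
      have : Nonempty (Fin d) := ⟨⟨0, hk.trans hkd⟩⟩
      infer_instance
    -- Homogeneity in y reduces to unit vectors; for y = 0 any unit z will do.
    obtain ⟨z, hz, hyz⟩ : ∃ z : EuclideanSpace ℝ (Fin d), ‖z‖ = 1 ∧
        WithLp.toLp 2 y = ‖(WithLp.toLp 2 y : EuclideanSpace ℝ (Fin d))‖ • z := by
      by_cases h0 : (WithLp.toLp 2 y : EuclideanSpace ℝ (Fin d)) = 0
      · obtain ⟨z, hz⟩ := exists_norm_eq (EuclideanSpace ℝ (Fin d)) zero_le_one
        exact ⟨z, hz, by simp [h0]⟩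
      · have hn := norm_ne_zero_iff.mpr h0
        refine ⟨‖(WithLp.toLp 2 y : EuclideanSpace ℝ (Fin d))‖⁻¹ • WithLp.toLp 2 y, ?_, ?_⟩
        · rw [norm_smul, norm_inv, norm_norm, inv_mul_cancel₀ hn]
        · rw [smul_inv_smul₀ hn]
    have h1 : (fun x : {x : EuclideanSpace ℝ (Fin d) // ‖x‖ = 1} =>
        (∑ i, y i * x.1.ofLp i) ^ t) = ‖(WithLp.toLp 2 y : EuclideanSpace ℝ (Fin d))‖ ^ t •
          fun x : {x : EuclideanSpace ℝ (Fin d) // ‖x‖ = 1} => (inner ℝ x.1 z : ℝ) ^ t := by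
      funext x
      rw [Pi.smul_apply, smul_eq_mul, ← mul_pow, ← real_inner_smul_right, ← hyz,
        EuclideanSpace.inner_eq_star_dotProduct]
      rfl
    rw [h1]
    exact Submodule.smul_mem _ _ (hunit t le_rfl z hz)
  obtain ⟨a, ha⟩ := exists_sum_smul_of_mem_span
    (monomial_mem_of_forall_pow_mem W (fun x i => x.1.ofLp i) t hall hα)
  refine ⟨a, fun x hx => ?_⟩
  have := congrFun ha ⟨x, hx⟩
  rw [Finset.sum_apply] at this
  exact this.symm

/-! ### Averages over projections of rank one -/

theorem conj_coordProj_apply (hd : 1 ≤ d) (U : Matrix.orthogonalGroup (Fin d) ℝ) (i j : Fin d) :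
    (conj U (coordProj hd)).mat i j = U.1 i ⟨0, hd⟩ * U.1 j ⟨0, hd⟩ := by
  have h : ∀ l : Fin d, (l : ℕ) < 1 ↔ l = ⟨0, hd⟩ := fun l => by
    rw [Nat.lt_one_iff, Fin.ext_iff]
  rw [conj_mat_apply]
  simp [coordProj, Grassmannian.mat, dotProduct, Matrix.mulVec_diagonal, h]

/-- The projection is uuᵀ with u the first column of U, so the monomial equals u^β (u⬝x)^t, and
(u⬝x)^t expands multinomially. -/
theorem mono_conj_coordProj_mulVec (hd : 1 ≤ d) (U : Matrix.orthogonalGroup (Fin d) ℝ) {t : ℕ}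
    {β : Fin d → ℕ} (hβ : ∑ i, β i = t) (x : Fin d → ℝ) :
    mono ((conj U (coordProj hd)).mat *ᵥ x) β =
      ∑ γ ∈ indexEq d t, (Nat.multinomial Finset.univ γ : ℝ) *
        (mono (fun i => U.1 i ⟨0, hd⟩) β * mono (fun i => U.1 i ⟨0, hd⟩) γ) * mono x γ := by
  have h : ∀ i, ((conj U (coordProj hd)).mat *ᵥ x) i =
      U.1 i ⟨0, hd⟩ * ∑ j, U.1 j ⟨0, hd⟩ * x j := fun i => by
    simp only [Matrix.mulVec, dotProduct, conj_coordProj_apply, mul_assoc, Finset.mul_sum]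
  simp only [mono, h, mul_pow, Finset.prod_mul_distrib]
  rw [Finset.prod_pow_eq_pow_sum, hβ, Finset.sum_pow_eq_sum_piAntidiag, Finset.mul_sum]
  refine Finset.sum_congr rfl fun γ _ => ?_
  simp only [mul_pow, Finset.prod_mul_distrib]
  ring

theorem continuous_orthogonalGroup_apply (i j : Fin d) :
    Continuous fun U : Matrix.orthogonalGroup (Fin d) ℝ => U.1 i j :=
  (continuous_apply j).comp ((continuous_apply i).comp continuous_subtype_val)

theorem exists_eq_norm_smul_column (hd : 1 ≤ d) (x : EuclideanSpace ℝ (Fin d)) :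
    ∃ U : Matrix.orthogonalGroup (Fin d) ℝ, ∀ i, x.ofLp i = ‖x‖ * U.1 i ⟨0, hd⟩ := by
  obtain ⟨U, hU⟩ := exists_orthogonal_rows (fun i : Fin d => if i = ⟨0, hd⟩ then x else 0) <| by
    intro i j hij
    by_cases hi : i = ⟨0, hd⟩
    · simp [hi, (hi ▸ hij).symm]
    · simp [hi]
  -- The inverse is the transpose and turns the row into a column.
  refine ⟨U⁻¹, fun i => ?_⟩
  have := congrFun (hU ⟨0, hd⟩) i
  simpa using this

/-- The monomials of degree `t` are combinations of the monomials of degree `t` averaged over the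
projections of rank one. -/
theorem exists_mono_eq_sum_line (hd : 1 ≤ d) {t : ℕ} {α : Fin d → ℕ} (hα : ∑ i, α i = t) :
    ∃ a : (Fin d → ℕ) → ℝ, ∀ x : EuclideanSpace ℝ (Fin d), mono x.ofLp α = ∑ β ∈ indexEq d t,
      a β * ∫ Q : Grassmannian 1 d, mono (Q.mat *ᵥ x.ofLp) β ∂(grassmannMeasure hd) := by
  set F : (Fin d → ℕ) → EuclideanSpace ℝ (Fin d) → ℝ := fun β x =>
    ∫ Q : Grassmannian 1 d, mono (Q.mat *ᵥ x.ofLp) β ∂(grassmannMeasure hd) with hF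
  suffices h : (fun x : EuclideanSpace ℝ (Fin d) => mono x.ofLp α) ∈
      Submodule.span ℝ (F '' ↑(indexEq d t)) by
    obtain ⟨a, ha⟩ := exists_sum_smul_of_mem_span h
    refine ⟨a, fun x => ?_⟩
    have := congrFun ha x
    rw [Finset.sum_apply] at this
    exact this.symm
  by_contra hv
  obtain ⟨l, hl, hW⟩ := Submodule.exists_le_ker_of_notMem hv
  set u : Matrix.orthogonalGroup (Fin d) ℝ → Fin d → ℝ := fun U i => U.1 i ⟨0, hd⟩ with hu
  -- The separating functional l yields the coefficients of a form q. That l kills every F β will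
  -- say that q is orthogonal in L² to all monomials of degree t, hence to itself.
  set c : (Fin d → ℕ) → ℝ := fun γ => (Nat.multinomial Finset.univ γ : ℝ) *
    l fun x : EuclideanSpace ℝ (Fin d) => mono x.ofLp γ with hc
  have hcu : ∀ β, Continuous fun U => mono (u U) β := fun β =>
    continuous_finsetProd _ fun i _ => (continuous_orthogonalGroup_apply i _).pow _
  have hFeq : ∀ β ∈ indexEq d t, F β = ∑ γ ∈ indexEq d t,
      ((Nat.multinomial Finset.univ γ : ℝ) * ∫ U, mono (u U) β * mono (u U) γ ∂(haarO d)) •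
        fun x : EuclideanSpace ℝ (Fin d) => mono x.ofLp γ := by
    intro β hβ
    funext x
    simp only [hF]
    rw [integral_grassmannMeasure hd (continuous_mono_mulVec x.ofLp β), Finset.sum_apply]
    simp only [mono_conj_coordProj_mulVec hd _ (mem_indexEq.mp hβ)]
    rw [integral_finsetSum]
    swap
    · exact fun γ _ => integrable_haarO
        ((continuous_const.mul ((hcu β).mul (hcu γ))).mul continuous_const)
    refine Finset.sum_congr rfl fun γ _ => ?_
    rw [integral_mul_const, integral_const_mul]
    rfl
  set q : (Fin d → ℝ) → ℝ := fun y => ∑ γ ∈ indexEq d t, c γ * mono y γ with hq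
  have hcq : Continuous fun U => q (u U) :=
    continuous_finsetSum _ fun γ _ => continuous_const.mul (hcu γ)
  have horth : ∀ β ∈ indexEq d t, ∫ U, mono (u U) β * q (u U) ∂(haarO d) = 0 := by
    intro β hβ
    have h0 : l (F β) = 0 := hW (Submodule.subset_span ⟨β, hβ, rfl⟩)
    rw [hFeq β hβ, map_sum] at h0
    rw [← h0]
    simp only [hq, Finset.mul_sum]
    rw [integral_finsetSum]
    swap
    · exact fun γ _ => integrable_haarO ((hcu β).mul (continuous_const.mul (hcu γ)))
    refine Finset.sum_congr rfl fun γ _ => ?_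
    simp only [mul_left_comm _ (c γ)]
    rw [integral_const_mul, map_smul, smul_eq_mul]
    ring
  have hqq : ∫ U, q (u U) * q (u U) ∂(haarO d) = 0 := by
    have : ∀ U, q (u U) * q (u U) = ∑ β ∈ indexEq d t, c β * (mono (u U) β * q (u U)) := by
      intro U
      rw [hq, Finset.sum_mul]
      simp only [mul_assoc]
    simp only [this]
    rw [integral_finsetSum]
    swap
    · exact fun β _ => integrable_haarO (continuous_const.mul ((hcu β).mul hcq))
    refine Finset.sum_eq_zero fun β hβ => ?_
    rw [integral_const_mul, horth β hβ, mul_zero]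
  have hq0 : ∀ U, q (u U) = 0 := by
    intro U
    by_contra hne
    exact (Continuous.integral_pos_of_hasCompactSupport_nonneg_nonzero (μ := haarO d) (x := U)
      (hcq.mul hcq) (HasCompactSupport.of_compactSpace _) (fun V => mul_self_nonneg _)
      (mul_self_ne_zero.mpr hne)).ne' hqq
  -- Every vector is a multiple of a first column, so homogeneity carries the vanishing of q to all
  -- of ℝ^d. Its coefficients then vanish, contradicting l(x^α) ≠ 0.
  have hqy : ∀ y : Fin d → ℝ, q y = 0 := by
    intro y
    obtain ⟨U, hU⟩ := exists_eq_norm_smul_column hd (WithLp.toLp 2 y)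
    have : q y = ‖(WithLp.toLp 2 y : EuclideanSpace ℝ (Fin d))‖ ^ t * q (u U) := by
      rw [hq, Finset.mul_sum]
      refine Finset.sum_congr rfl fun γ hγ => ?_
      have hm : mono y γ = ‖(WithLp.toLp 2 y : EuclideanSpace ℝ (Fin d))‖ ^ t * mono (u U) γ := by
        rw [mono, mono, ← mem_indexEq.mp hγ, ← Finset.prod_pow_eq_pow_sum,
          ← Finset.prod_mul_distrib]
        refine Finset.prod_congr rfl fun i _ => ?_
        rw [← mul_pow]
        exact congrArg (· ^ γ i) (hU i)
      rw [hm]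
      ring
    rw [this, hq0, mul_zero]
  exact hl ((mul_eq_zero.mp (coeff_eq_zero_of_forall_eval t c hqy
    (mem_indexEq.mpr hα))).resolve_left (multinomial_ne_zero α))

end MomentFusion
-- Assembly of the two reconstruction results
theorem mainTheorem8 (d : ℕ) (hd : 1 ≤ d) (t : ℕ) (α : Fin d → ℕ) (hα : ∑ i, α i = t) :
    -- random vectors on the unit sphere, projections of arbitrary rank `k`
    (∀ (k : ℕ) (_ : 1 ≤ k) (hkd : k ≤ d),
      (∃ a, MomentFusion.ReconstructsSphere.{u} hkd t α a) ∧
      ∀ a, MomentFusion.ReconstructsSphere.{u} hkd t α a → ∃ c : ℝ,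
        ∀ (ε : ℝ) (n : ℕ) (P : Fin n → MomentFusion.Grassmannian k d) (w : Fin n → ℝ),
          MomentFusion.IsApproxCubature hkd t ε P w →
          ∀ (Ω : Type u) [MeasurableSpace Ω] (μ : Measure Ω) [IsProbabilityMeasure μ]
            (X : Ω → EuclideanSpace ℝ (Fin d)), AEMeasurable X μ → (∀ᵐ ω ∂μ, ‖X ω‖ = 1) →
            |∫ ω, MomentFusion.mono (X ω).ofLp α ∂μ -
              MomentFusion.fusedMoment (MomentFusion.indexLE d t) a P w μ X| ≤ ε * c) ∧
    -- random vectors in `ℝ^d`, projections of rank one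
    (t ≤ d →
      (∃ a, MomentFusion.ReconstructsLine.{u} hd t α a) ∧
      ∀ a, MomentFusion.ReconstructsLine.{u} hd t α a → ∃ c : ℝ,
        ∀ (ε : ℝ) (n : ℕ) (P : Fin n → MomentFusion.Grassmannian 1 d) (w : Fin n → ℝ),
          MomentFusion.IsApproxCubature hd t ε P w →
          ∀ (Ω : Type u) [MeasurableSpace Ω] (μ : Measure Ω) [IsProbabilityMeasure μ]
            (X : Ω → EuclideanSpace ℝ (Fin d)), AEMeasurable X μ →
            Integrable (fun ω => ‖X ω‖ ^ t) μ →
            |∫ ω, MomentFusion.mono (X ω).ofLp α ∂μ -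
              MomentFusion.fusedMoment (MomentFusion.indexEq d t) a P w μ X| ≤
              c * (ε * ∫ ω, ‖X ω‖ ^ t ∂μ)) := by
  refine ⟨fun k hk hkd => ⟨?_, fun a ha => ?_⟩, fun _ => ⟨?_, fun a ha => ?_⟩⟩
  · obtain ⟨a, ha⟩ := MomentFusion.exists_mono_eq_sum_sphere hk hkd hα
    refine ⟨a, fun n P w hP Ω _ μ _ X hX hX1 => ?_⟩
    have hint := MomentFusion.integrable_norm_pow_of_norm_eq_one hX1
    exact MomentFusion.moment_eq_fusedMoment le_rfl hα
      (fun β hβ => MomentFusion.mem_indexLE.mp hβ) hP hX (hint t) (fun β _ => hint _)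
      (hX1.mono fun ω hω => ha _ hω)
  · obtain ⟨c, hc⟩ := MomentFusion.exists_abs_moment_sub_fusedMoment_le.{u} hk hkd hα
      (B := MomentFusion.indexLE d t) (S := {x | ‖x‖ = 1}) (a := a)
      (fun β hβ => MomentFusion.mem_indexLE.mp hβ)
      (fun β _ x (hx : ‖x‖ = 1) => by rw [hx, one_pow, one_pow])
      (fun x (hx : ‖x‖ = 1) => MomentFusion.mono_eq_sum_of_forall_fusedMoment.{u} hk hkd
        (fun β hβ => MomentFusion.mem_indexLE.mp hβ) fun n P w hP =>
          ha n P w hP PUnit (Measure.dirac PUnit.unit) (fun _ => x) aemeasurable_const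
            (Filter.Eventually.of_forall fun _ => hx))
    refine ⟨c, fun ε n P w hP Ω _ μ _ X hX hX1 => ?_⟩
    have h := hc ε n P w hP Ω μ X hX hX1
      (MomentFusion.integrable_norm_pow_of_norm_eq_one hX1 t)
    have h1 : ∫ ω, ‖X ω‖ ^ t ∂μ = 1 := by
      rw [integral_congr_ae (hX1.mono fun ω hω => by rw [hω, one_pow] : _ =ᵐ[μ] fun _ => (1 : ℝ))]
      simp
    rwa [h1, mul_one, mul_comm] at h
  · obtain ⟨a, ha⟩ := MomentFusion.exists_mono_eq_sum_line hd hα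
    refine ⟨a, fun n P w hP Ω _ μ _ X hX hXt => ?_⟩
    exact MomentFusion.moment_eq_fusedMoment (by norm_num) hα
      (fun β hβ => (MomentFusion.mem_indexEq.mp hβ).le) hP hX hXt
      (fun β hβ => by rwa [MomentFusion.mem_indexEq.mp hβ])
      (Filter.Eventually.of_forall fun ω => ha _)
  · obtain ⟨c, hc⟩ := MomentFusion.exists_abs_moment_sub_fusedMoment_le.{u} le_rfl hd hα
      (B := MomentFusion.indexEq d t) (S := Set.univ) (a := a)
      (fun β hβ => (MomentFusion.mem_indexEq.mp hβ).le)
      (fun β hβ x _ => by rw [MomentFusion.mem_indexEq.mp hβ])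
      (fun x _ => MomentFusion.mono_eq_sum_of_forall_fusedMoment.{u} le_rfl hd
        (fun β hβ => (MomentFusion.mem_indexEq.mp hβ).le) fun n P w hP =>
          ha n P w hP PUnit (Measure.dirac PUnit.unit) (fun _ => x) aemeasurable_const
            (integrable_const _))
    exact ⟨c, fun ε n P w hP Ω _ μ _ X hX hXt => hc ε n P w hP Ω μ X hX
      (Filter.Eventually.of_forall fun _ => trivial) hXt⟩
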